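/- Let $A$ be a unital C*-algebra, let $G$ be a finite group, and let $\alpha\colon G\to\operatorname{Aut}(A)$ be an action. For a positive element $a$ of a C*-algebra $A$ write $\operatorname{Her}(a)=\overline{aAa}$. For positive $a,b\in A$ write $a\sim_s b$ if there is $x\in A$ with $a=xx^*$ and $\operatorname{Her}(x^*x)=\operatorname{Her}(b)$, and write $a\precsim b$ if $a\sim_s a'$ for some positive $a'\in\operatorname{Her}(b)$. An element is full if the closed two-sided ideal it generates is all of $A$. A C*-algebra has Property (SP) if each of its nonzero hereditary C*-subalgebras contains a nonzero projection. The action $\alpha$ has the weak tracial Rokhlin property if for every finite set $F\subset A$, every $\varepsilon>0$, every positive $b\in A$ with $\|b\|=1$ and every full positive $x\in A$, there are mutually orthogonal projections $e_g\in A$ $(g\in G)$ such that, with $e=\sum_{g\in G}e_g$, (1) $\|\alpha_g(e_h)-e_{gh}\|<\varepsilon$ for all $g,h\in G$; (2) $\|e_ga-ae_g\|<\varepsilon$ for all $g\in G$ and $a\in F$; (3) $1-e\precsim x$; (4) $\|ebe\|>1-\varepsilon$. Suppose that $A$ has Property (SP) and that $\alpha$ has the weak tracial Rokhlin property. Then the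 crossed product $C^*(G,A,\alpha)$ has Property (SP). Moreover, every nonzero hereditary C*-subalgebra of $C^*(G,A,\alpha)$ contains a nonzero projection that is Murray--von Neumann equivalent in $C^*(G,A,\alpha)$ to a projection in $A$ (where $A$ is regarded as a subalgebra of $C^*(G,A,\alpha)$ via the canonical inclusion). -/

import Mathlib

/-- Murray-von Neumann equivalence of `p` and `q` (in the algebra `A`). -/
def MurrayVonNeumannEquiv {A : Type*} [Mul A] [Star A] (p q : A) : Prop :=
  ∃ v : A, star v * v = p ∧ v * star v = q

/-- A hereditary C*-subalgebra: a norm-closed *-subalgebra `D` such that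
`0 ≤ a ≤ b` and `b ∈ D` imply `a ∈ D`. -/
def IsHereditaryCStarSubalgebra {A : Type*} [NonUnitalCStarAlgebra A] [PartialOrder A]
    (D : NonUnitalStarSubalgebra ℂ A) : Prop :=
  IsClosed (D : Set A) ∧ ∀ a b : A, 0 ≤ a → a ≤ b → b ∈ D → a ∈ D

/-- Property (SP): every nonzero hereditary C*-subalgebra contains a nonzero projection. -/
def PropertySP (A : Type*) [NonUnitalCStarAlgebra A] [PartialOrder A] : Prop :=
  ∀ D : NonUnitalStarSubalgebra ℂ A, IsHereditaryCStarSubalgebra D → D ≠ ⊥ →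
    ∃ p ∈ D, IsStarProjection p ∧ p ≠ 0

/-- `Her(a)`, the closure of `aAa` (used for positive `a` only). -/
def Her {A : Type*} [NonUnitalCStarAlgebra A] (a : A) : Set A :=
  closure (Set.range fun c : A => a * c * a)

/-- The relation `a ∼ₛ b` between positive elements. -/
def BlackadarEquiv {A : Type*} [NonUnitalCStarAlgebra A] (a b : A) : Prop :=
  ∃ x : A, a = x * star x ∧ Her (star x * x) = Her b

/-- Blackadar's comparison `a ≾ b` of positive elements: `a ∼ₛ a'` for a positive
`a' ∈ Her(b)`. -/
def BlackadarLE {A : Type*} [NonUnitalCStarAlgebra A] [PartialOrder A] (a b : A) : Prop :=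
  ∃ a' ∈ Her b, 0 ≤ a' ∧ BlackadarEquiv a a'

/-- An element is full if the closed two-sided ideal it generates is the whole algebra. -/
def IsFullElement {A : Type*} [NonUnitalCStarAlgebra A] (x : A) : Prop :=
  closure (TwoSidedIdeal.span {x} : Set A) = Set.univ

/-- The weak tracial Rokhlin property of an action of a finite group on a unital C*-algebra. -/
def WeakTracialRokhlin {G A : Type*} [Group G] [Fintype G] [CStarAlgebra A] [PartialOrder A]
    (α : G →* (A ≃⋆ₐ[ℂ] A)) : Prop :=
  ∀ (F : Finset A) (ε : ℝ), 0 < ε → ∀ b : A, 0 ≤ b → ‖b‖ = 1 →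
    ∀ x : A, 0 ≤ x → IsFullElement x →
      ∃ e : G → A, (∀ g, IsStarProjection (e g)) ∧ (∀ g h, g ≠ h → e g * e h = 0) ∧
        (∀ g h, ‖α g (e h) - e (g * h)‖ < ε) ∧
        (∀ g, ∀ a ∈ F, ‖e g * a - a * e g‖ < ε) ∧
        BlackadarLE (1 - ∑ g, e g) x ∧
        1 - ε < ‖(∑ g, e g) * b * (∑ g, e g)‖

/-- The crossed product `C*(G, A, α)` of a unital C*-algebra by a finite group. The element with
coefficients `f : G → A` stands for `∑ g, f g * u g`; the product and the involution are the ones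
determined by `u g * a = α g a * u g` and by `u g` being unitary, and the norm is the C*-norm. As
`G` is finite, no completion is needed. -/
@[ext] structure CrossedProduct {G A : Type*} [Group G] [CStarAlgebra A]
    (α : G →* (A ≃⋆ₐ[ℂ] A)) where
  /-- The coefficients of an element. -/
  coeff : G → A

namespace CrossedProduct

section Algebra

set_option linter.unusedSectionVars false

variable {G A : Type*} [Group G] [Fintype G] [DecidableEq G] [CStarAlgebra A]
  {α : G →* (A ≃⋆ₐ[ℂ] A)}

/-- An element of the crossed product is the same as its family of coefficients. -/
def coeffEquiv (α : G →* (A ≃⋆ₐ[ℂ] A)) : CrossedProduct α ≃ (G → A) where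
  toFun f := f.coeff
  invFun f := ⟨f⟩

noncomputable instance : AddCommGroup (CrossedProduct α) := (coeffEquiv α).addCommGroup

noncomputable instance : Module ℂ (CrossedProduct α) := (coeffEquiv α).module ℂ

noncomputable instance : Mul (CrossedProduct α) :=
  ⟨fun f k => ⟨fun t => ∑ s, f.coeff s * α s (k.coeff (s⁻¹ * t))⟩⟩

noncomputable instance : Star (CrossedProduct α) :=
  ⟨fun f => ⟨fun t => α t (star (f.coeff t⁻¹))⟩⟩

noncomputable instance : One (CrossedProduct α) := ⟨⟨fun t => if t = 1 then 1 else 0⟩⟩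

theorem zero_apply (t : G) : (0 : CrossedProduct α).coeff t = 0 := rfl

theorem add_apply (f k : CrossedProduct α) (t : G) :
    (f + k).coeff t = f.coeff t + k.coeff t := rfl

theorem smul_apply (c : ℂ) (f : CrossedProduct α) (t : G) :
    (c • f).coeff t = c • f.coeff t := rfl

theorem mul_apply (f k : CrossedProduct α) (t : G) :
    (f * k).coeff t = ∑ s, f.coeff s * α s (k.coeff (s⁻¹ * t)) := rfl

theorem star_apply (f : CrossedProduct α) (t : G) :
    (star f).coeff t = α t (star (f.coeff t⁻¹)) := rfl

theorem one_apply (t : G) : (1 : CrossedProduct α).coeff t = if t = 1 then 1 else 0 := rfl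

theorem sum_apply {ι : Type*} (s : Finset ι) (f : ι → CrossedProduct α) (t : G) :
    (∑ i ∈ s, f i).coeff t = ∑ i ∈ s, (f i).coeff t :=
  map_sum (⟨⟨fun k : CrossedProduct α => k.coeff t, rfl⟩, fun _ _ => rfl⟩ :
    CrossedProduct α →+ A) f s

/-- The regular representation: the matrix of the operator `∑ g, f g * u g` on `A ^ G`, where
`(a ξ) h = α h⁻¹ a * ξ h` and `(u g ξ) h = ξ (g⁻¹ * h)`. -/
def regular (f : CrossedProduct α) : CStarMatrix G G A :=
  CStarMatrix.ofMatrix fun h k => α h⁻¹ (f.coeff (h * k⁻¹))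

theorem regular_apply (f : CrossedProduct α) (h k : G) :
    regular f h k = α h⁻¹ (f.coeff (h * k⁻¹)) := rfl

theorem regular_injective : Function.Injective (regular (α := α)) := by
  intro f k hfk
  ext t
  have h := congrFun (congrFun hfk t) 1
  rw [regular_apply, regular_apply] at h
  simpa using (α t⁻¹).injective h

theorem regular_add (f k : CrossedProduct α) : regular (f + k) = regular f + regular k := by
  ext h l
  simp [regular_apply, add_apply]

theorem regular_zero : regular (0 : CrossedProduct α) = 0 := by
  ext h l
  exact map_zero (α h⁻¹)

theorem regular_smul (c : ℂ) (f : CrossedProduct α) : regular (c • f) = c • regular f := by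
  ext h l
  simp [regular_apply, smul_apply]

theorem regular_one : regular (1 : CrossedProduct α) = 1 := by
  ext h l
  rw [regular_apply, one_apply, CStarMatrix.one_apply]
  by_cases hl : h = l <;> simp [hl, mul_inv_eq_one]

theorem regular_mul (f k : CrossedProduct α) : regular (f * k) = regular f * regular k := by
  ext h l
  rw [regular_apply, mul_apply, CStarMatrix.mul_apply, map_sum]
  refine Fintype.sum_equiv ((Equiv.inv G).trans (Equiv.mulRight h)) _ _ fun s => ?_
  have hs : ∀ x : A, α h⁻¹ (α s x) = α (s⁻¹ * h)⁻¹ x := fun x => by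
    rw [← StarAlgEquiv.mul_apply, ← map_mul, mul_inv_rev, inv_inv]
  simp only [regular_apply, map_mul (α h⁻¹), Equiv.trans_apply, Equiv.inv_apply,
    Equiv.coe_mulRight, hs]
  congr 3 <;> group

theorem regular_star (f : CrossedProduct α) : regular (star f) = star (regular f) := by
  ext h l
  rw [CStarMatrix.star_apply, regular_apply, regular_apply, star_apply,
    ← StarAlgEquiv.mul_apply, ← map_mul, ← map_star]
  congr 2 <;> group

noncomputable instance : Ring (CrossedProduct α) where
  left_distrib a b c := regular_injective (by simp only [regular_mul, regular_add, mul_add])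
  right_distrib a b c := regular_injective (by simp only [regular_mul, regular_add, add_mul])
  zero_mul a := regular_injective (by simp only [regular_mul, regular_zero, zero_mul])
  mul_zero a := regular_injective (by simp only [regular_mul, regular_zero, mul_zero])
  mul_assoc a b c := regular_injective (by simp only [regular_mul, mul_assoc])
  one_mul a := regular_injective (by simp only [regular_mul, regular_one, one_mul])
  mul_one a := regular_injective (by simp only [regular_mul, regular_one, mul_one])
  neg_add_cancel a := neg_add_cancel a
  sub_eq_add_neg a b := sub_eq_add_neg a b
  zsmul := fun n a => n • a
  zsmul_zero' a := SubNegMonoid.zsmul_zero' a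
  zsmul_succ' n a := SubNegMonoid.zsmul_succ' n a
  zsmul_neg' n a := SubNegMonoid.zsmul_neg' n a

noncomputable instance : StarRing (CrossedProduct α) where
  star_involutive a := regular_injective (by simp only [regular_star, star_star])
  star_mul a b := regular_injective (by simp only [regular_star, regular_mul, star_mul])
  star_add a b := regular_injective (by simp only [regular_star, regular_add, star_add])

noncomputable instance : Algebra ℂ (CrossedProduct α) :=
  Algebra.ofModule
    (fun c a b => regular_injective (by simp only [regular_mul, regular_smul, smul_mul_assoc]))
    (fun c a b => regular_injective (by simp only [regular_mul, regular_smul, mul_smul_comm]))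

instance : StarModule ℂ (CrossedProduct α) :=
  ⟨fun c a => regular_injective (by simp only [regular_star, regular_smul, star_smul])⟩

/-- The regular representation as a homomorphism of *-algebras. -/
noncomputable def regularHom : CrossedProduct α →⋆ₐ[ℂ] CStarMatrix G G A where
  toFun := regular
  map_one' := regular_one
  map_mul' := regular_mul
  map_zero' := regular_zero
  map_add' := regular_add
  commutes' c := by
    rw [Algebra.algebraMap_eq_smul_one, regular_smul, regular_one,
      ← Algebra.algebraMap_eq_smul_one]
  map_star' := regular_star

end Algebra

section Norm

set_option linter.unusedSectionVars false

variable {G A : Type*} [Group G] [Fintype G] [DecidableEq G] [CStarAlgebra A] [PartialOrder A]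
  [StarOrderedRing A] {α : G →* (A ≃⋆ₐ[ℂ] A)}

/-- The norm is the operator norm in the (faithful) regular representation. -/
noncomputable instance : NormedRing (CrossedProduct α) :=
  NormedRing.induced (CrossedProduct α) (CStarMatrix G G A) (regularHom (α := α))
    regular_injective

noncomputable instance : NormedAlgebra ℂ (CrossedProduct α) :=
  NormedAlgebra.induced ℂ (CrossedProduct α) (CStarMatrix G G A) (regularHom (α := α))

theorem norm_eq (f : CrossedProduct α) : ‖f‖ = ‖regular f‖ := rfl

theorem isometry_regularHom : Isometry (regularHom (α := α)) :=
  AddMonoidHomClass.isometry_of_norm _ fun _ => rfl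

theorem range_regularHom :
    Set.range (regularHom (α := α)) = {M | ∀ h k, M h k = α k⁻¹ (M (h * k⁻¹) 1)} := by
  ext M
  constructor
  · rintro ⟨f, rfl⟩ h k
    change regular f h k = α k⁻¹ (regular f (h * k⁻¹) 1)
    rw [regular_apply, regular_apply, ← StarAlgEquiv.mul_apply, ← map_mul]
    congr 2 <;> group
  · intro hM
    refine ⟨⟨fun t => α t (M t 1)⟩, ?_⟩
    ext h k
    change α h⁻¹ (α (h * k⁻¹) (M (h * k⁻¹) 1)) = M h k
    rw [hM h k, ← StarAlgEquiv.mul_apply, ← map_mul]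
    congr 2
    group

theorem isClosed_range_regularHom : IsClosed (Set.range (regularHom (α := α))) := by
  rw [range_regularHom]
  have hc : ∀ h k : G, Continuous fun M : CStarMatrix G G A => M h k := fun h k =>
    (continuous_apply k).comp (continuous_apply (A := fun _ : G => G → A) h)
  simp only [Set.ofPred_forall]
  exact isClosed_iInter fun h => isClosed_iInter fun k =>
    isClosed_eq (hc h k) ((NonUnitalStarAlgHom.isometry (α k⁻¹)
      (EquivLike.injective _)).continuous.comp (hc _ _))

noncomputable instance : CStarAlgebra (CrossedProduct α) where
  toCompleteSpace := by
    rw [completeSpace_iff_isComplete_range isometry_regularHom.isUniformInducing]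
    exact isClosed_range_regularHom.isComplete
  norm_mul_self_le f := by
    simp only [norm_eq, regular_mul, regular_star]
    exact CStarRing.norm_mul_self_le (regular f)

noncomputable instance : PartialOrder (CrossedProduct α) := CStarAlgebra.spectralOrder _

instance : StarOrderedRing (CrossedProduct α) := CStarAlgebra.spectralOrderedRing _

/-- The canonical inclusion of `A` into the crossed product. -/
noncomputable def of (α : G →* (A ≃⋆ₐ[ℂ] A)) : A →⋆ₐ[ℂ] CrossedProduct α where
  toFun a := ⟨fun t => if t = 1 then a else 0⟩
  map_one' := rfl
  map_mul' a b := by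
    ext t
    rw [mul_apply, Finset.sum_eq_single 1 (fun s _ hs => by simp [hs]) (by simp)]
    by_cases ht : t = 1 <;> simp [ht]
  map_zero' := by ext t; exact ite_self 0
  map_add' a b := by
    ext t
    rw [add_apply]
    by_cases ht : t = 1 <;> simp [ht]
  commutes' c := by
    ext t
    rw [Algebra.algebraMap_eq_smul_one, Algebra.algebraMap_eq_smul_one, smul_apply, one_apply]
    by_cases ht : t = 1 <;> simp [ht]
  map_star' a := by
    ext t
    rw [star_apply]
    by_cases ht : t = 1 <;> simp [ht]

theorem of_apply (a : A) (t : G) : (of α a).coeff t = if t = 1 then a else 0 := rfl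

/-- The canonical unitaries of the crossed product. -/
noncomputable def u (α : G →* (A ≃⋆ₐ[ℂ] A)) (g : G) : CrossedProduct α :=
  ⟨fun t => if t = g then 1 else 0⟩

theorem u_apply (g t : G) : (u α g).coeff t = if t = g then 1 else 0 := rfl

theorem of_mul_u_apply (a : A) (g t : G) :
    (of α a * u α g).coeff t = if t = g then a else 0 := by
  rw [mul_apply, Finset.sum_eq_single 1 (fun s _ hs => by simp [of_apply, hs]) (by simp)]
  by_cases ht : t = g <;> simp [of_apply, u_apply, ht]

theorem u_mul_u (g h : G) : u α g * u α h = u α (g * h) := by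
  ext t
  rw [mul_apply, Finset.sum_eq_single g (fun s _ hs => by simp [u_apply, hs]) (by simp)]
  simp only [u_apply, inv_mul_eq_iff_eq_mul]
  by_cases ht : t = g * h <;> simp [ht]

theorem star_u (g : G) : star (u α g) = u α g⁻¹ := by
  ext t
  simp only [star_apply, u_apply, inv_eq_iff_eq_inv]
  by_cases ht : t = g⁻¹ <;> simp [ht]

theorem u_mul_of (g : G) (a : A) : u α g * of α a = of α (α g a) * u α g := by
  ext t
  rw [of_mul_u_apply, mul_apply,
    Finset.sum_eq_single g (fun s _ hs => by simp [u_apply, hs]) (by simp)]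
  simp only [u_apply, of_apply, inv_mul_eq_one]
  by_cases ht : g = t
  · simp [ht]
  · simp [ht, Ne.symm ht]

/-- Every element of the crossed product is `∑ g, f g * u g`. -/
theorem eq_sum (f : CrossedProduct α) : f = ∑ g, of α (f.coeff g) * u α g := by
  ext t
  rw [sum_apply]
  simp [of_mul_u_apply]

/-- The universal property of the (full) crossed product: every covariant representation of
`(G, A, α)` on a unital C*-algebra comes from a unique representation of the C*-algebra
`CrossedProduct α`. -/
theorem existsUnique_lift {C : Type*} [CStarAlgebra C] (π : A →⋆ₐ[ℂ] C) (v : G →* unitary C)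
    (hπv : ∀ g a, (v g : C) * π a * star (v g : C) = π (α g a)) :
    ∃! Φ : CrossedProduct α →⋆ₐ[ℂ] C, (∀ a, Φ (of α a) = π a) ∧ ∀ g, Φ (u α g) = v g := by
  have hcomm : ∀ g a, (v g : C) * π a = π (α g a) * v g := fun g a => by
    rw [← hπv, mul_assoc, Unitary.coe_star_mul_self, mul_one]
  have hmul : ∀ s t, (v s : C) * v t = v (s * t) := fun s t => by rw [map_mul]; rfl
  have hstar : ∀ t, star (v t : C) = v t⁻¹ := fun t => by rw [map_inv]; rfl
  let Φ : CrossedProduct α →⋆ₐ[ℂ] C :=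
    { toFun := fun f => ∑ g, π (f.coeff g) * v g
      map_one' := by
        rw [Finset.sum_eq_single 1 (fun s _ hs => by simp [one_apply, hs]) (by simp)]
        simp [one_apply]
      map_mul' := fun f k => by
        simp only [mul_apply, map_sum, Finset.sum_mul, map_mul]
        rw [Finset.sum_comm]
        refine Finset.sum_congr rfl fun s _ => ?_
        rw [Finset.mul_sum]
        refine Fintype.sum_equiv (Equiv.mulLeft s⁻¹) _ _ fun t => ?_
        rw [Equiv.coe_mulLeft, mul_assoc (π (f.coeff s)) (v s : C),
          ← mul_assoc (v s : C), hcomm, mul_assoc (π _) (v s : C), hmul, mul_inv_cancel_left,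
          mul_assoc]
      map_zero' := by simp [zero_apply]
      map_add' := fun f k => by
        simp only [add_apply, map_add, add_mul, Finset.sum_add_distrib]
      commutes' := fun c => by
        rw [Finset.sum_eq_single 1
          (fun s _ hs => by simp [Algebra.algebraMap_eq_smul_one, smul_apply, one_apply, hs])
          (by simp)]
        simp [Algebra.algebraMap_eq_smul_one, smul_apply, one_apply]
      map_star' := fun f => by
        simp only [star_sum, star_mul, ← map_star]
        refine Fintype.sum_equiv (Equiv.inv G) _ _ fun t => ?_
        rw [Equiv.inv_apply, star_apply, hstar, hcomm, inv_inv] }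
  refine ⟨Φ, ⟨fun a => ?_, fun g => ?_⟩, fun Ψ hΨ => ?_⟩
  · change ∑ g, π ((of α a).coeff g) * v g = π a
    rw [Finset.sum_eq_single 1 (fun s _ hs => by simp [of_apply, hs]) (by simp)]
    simp [of_apply]
  · change ∑ t, π ((u α g).coeff t) * v t = v g
    rw [Finset.sum_eq_single g (fun s _ hs => by simp [u_apply, hs]) (by simp)]
    simp [u_apply]
  · ext f
    change Ψ f = ∑ g, π (f.coeff g) * v g
    conv_lhs => rw [eq_sum f]
    simp [hΨ.1, hΨ.2]

end Norm

end CrossedProduct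

/-! For `y ≠ 0` in `D` the identity coefficient of `star y * y` is positive and nonzero, since the
conditional expectation onto `A` is faithful; scale `y` to `x` so that this coefficient of `a = star
x * x` has norm one. A Rokhlin projection `e g` almost commutes with the coefficients of `a` and is
almost orthogonal to its nontrivial translates, so compressing by it nearly removes every other
coefficient (`norm_conjugate_sub_le`). By the norm condition on `e`, some corner of the identity
coefficient has norm above 3/4 (`exists_lt_norm_conjugate`). Property (SP) in `A` then gives a
nonzero projection `q` below `e g` with `q * a * q` at distance less than one from `q`
(`exists_projection_of_weakTracialRokhlin`). Polar decomposition of `x * q` carries `q` to an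
equivalent projection in `D`. -/

/-! ### Projections in hereditary subalgebras -/

section Hereditary

variable {A : Type*} [CStarAlgebra A]

/-- The two-sided annihilator of a selfadjoint element. -/
def annihilatorSubalgebra (m : A) (hm : IsSelfAdjoint m) : NonUnitalStarSubalgebra ℂ A where
  carrier := {y | m * y = 0 ∧ y * m = 0}
  add_mem' := fun {a b} ha hb => by
    simp only [Set.mem_ofPred_eq, mul_add, add_mul, ha.1, hb.1, ha.2, hb.2, add_zero, and_self]
  zero_mem' := by simp
  mul_mem' := fun {a b} ha hb => by
    simp only [Set.mem_ofPred_eq]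
    exact ⟨by rw [← mul_assoc, ha.1, zero_mul], by rw [mul_assoc, hb.2, mul_zero]⟩
  smul_mem' := fun c a ha => by
    simp only [Set.mem_ofPred_eq]
    exact ⟨by rw [mul_smul_comm, ha.1, smul_zero], by rw [smul_mul_assoc, ha.2, smul_zero]⟩
  star_mem' := fun {a} ha => by
    simp only [Set.mem_ofPred_eq]
    exact ⟨by simpa [hm.star_eq] using congr(star $(ha.2)),
      by simpa [hm.star_eq] using congr(star $(ha.1))⟩

theorem mem_annihilatorSubalgebra {m : A} {hm : IsSelfAdjoint m} {y : A} :
    y ∈ annihilatorSubalgebra m hm ↔ m * y = 0 ∧ y * m = 0 := Iff.rfl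

variable [PartialOrder A] [StarOrderedRing A]

/-- A hereditary C*-subalgebra contains `x * y * star x` for every element `x` of it and every
positive `y`. -/
theorem IsHereditaryCStarSubalgebra.conjugate_mem {D : NonUnitalStarSubalgebra ℂ A}
    (hD : IsHereditaryCStarSubalgebra D) {x y : A} (hx : x ∈ D) (hy : 0 ≤ y) :
    x * y * star x ∈ D := by
  refine hD.2 _ _ (star_right_conjugate_nonneg hy x)
    (CStarAlgebra.star_right_conjugate_le_norm_smul (hb := .of_nonneg hy)) ?_
  rw [← Complex.coe_smul]
  exact SMulMemClass.smul_mem _ (mul_mem hx (star_mem hx))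

/-- If `a` is positive and `m * a * m = 0` for a selfadjoint `m`, then `a * m = 0`. -/
theorem mul_eq_zero_of_conjugate_eq_zero {a m : A} (ha : 0 ≤ a) (hm : IsSelfAdjoint m)
    (h : m * a * m = 0) : a * m = 0 := by
  have hs : IsSelfAdjoint (CFC.sqrt a) := .of_nonneg (CFC.sqrt_nonneg a)
  have h0 : CFC.sqrt a * m = 0 := by
    rw [← CStarRing.star_mul_self_eq_zero_iff, star_mul, hm.star_eq, hs.star_eq, ← mul_assoc,
      mul_assoc m, CFC.sqrt_mul_sqrt_self a, h]
  rw [← CFC.sqrt_mul_sqrt_self a, mul_assoc, h0, mul_zero]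

/-- If `0 ≤ a ≤ b` and `b` annihilates `m`, then `m * a * m` is squeezed between 0 and 0. With `m =
1 - k(h)`, Property (SP) yields a projection having `k(h)` as a unit. -/
theorem isHereditaryCStarSubalgebra_annihilatorSubalgebra {m : A} (hm : IsSelfAdjoint m) :
    IsHereditaryCStarSubalgebra (annihilatorSubalgebra m hm) := by
  constructor
  · exact (isClosed_eq (continuous_const.mul continuous_id) continuous_const).inter
      (isClosed_eq (continuous_id.mul continuous_const) continuous_const)
  · intro a b ha hab hb
    have h : a * m = 0 := by
      refine mul_eq_zero_of_conjugate_eq_zero ha hm (le_antisymm ?_ (hm.conjugate_nonneg ha))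
      refine (hm.conjugate_le_conjugate hab).trans_eq ?_
      rw [mul_assoc, hb.2, mul_zero]
    exact ⟨by simpa [hm.star_eq, (IsSelfAdjoint.of_nonneg ha).star_eq] using congr(star $h), h⟩

/-- In a C*-algebra with Property (SP), a positive contraction `h` of norm more than `3 / 4` admits
a nonzero projection `q` on which it is at least `1 / 2`, and which every left unit of `h` fixes. -/
theorem PropertySP.exists_projection (hA : PropertySP A) {h : A} (h0 : 0 ≤ h) (h1 : ‖h‖ ≤ 1)
    (h2 : 3 / 4 < ‖h‖) :
    ∃ q : A, IsStarProjection q ∧ q ≠ 0 ∧ ‖h * q - q‖ ≤ 1 / 2 ∧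
      ∀ f : A, f * h = h → f * q = q := by
  have : Nontrivial A := ⟨h, 0, fun h' => by rw [h', norm_zero] at h2; norm_num at h2⟩
  have hsa : IsSelfAdjoint h := .of_nonneg h0
  have hspec : ∀ t ∈ spectrum ℝ h, 0 ≤ t ∧ t ≤ 1 := fun t ht =>
    ⟨spectrum_nonneg_of_nonneg h0 ht,
      (le_abs_self t).trans ((spectrum.norm_le_norm_of_mem ht).trans h1)⟩
  -- `k` rises from 0 at 1/2 to 1 at 3/4, and `r` lives where `k` is 1. Since `k` vanishes up to
  -- 1/2, `l` is a continuous version of `k t / t`.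
  let k : ℝ → ℝ := fun t => min 1 (max 0 (4 * t - 2))
  let l : ℝ → ℝ := fun t => k t / max t (1 / 2)
  let r : ℝ → ℝ := fun t => max 0 (t - 3 / 4)
  have hk : Continuous k := by fun_prop
  have hr : Continuous r := by fun_prop
  have hl : Continuous l := hk.div (by fun_prop) fun t =>
    (lt_of_lt_of_le (by norm_num) (le_max_right t (1 / 2))).ne'
  have hkl : ∀ t, t * l t = k t := by
    intro t
    rcases le_total t (1 / 2) with ht | ht
    · have : k t = 0 := by
        simp only [k]; rw [max_eq_left (by linarith), min_eq_right zero_le_one]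
      simp [l, this]
    · simp only [l]; rw [max_eq_left ht]; field_simp
  have hkr : ∀ t, k t * r t = r t := by
    intro t
    rcases le_total t (3 / 4) with ht | ht
    · have : r t = 0 := max_eq_left (by linarith)
      simp [this]
    · have : k t = 1 := by
        simp only [k]
        exact min_eq_left ((by linarith : (1 : ℝ) ≤ 4 * t - 2).trans (le_max_right _ _))
      simp [this]
  have hfac : h * cfc l h = cfc k h := by
    calc h * cfc l h = cfc (fun t : ℝ => t) h * cfc l h := by rw [cfc_id' ℝ h]
      _ = cfc k h := by
        rw [← cfc_mul (fun t => t) l h continuousOn_id hl.continuousOn]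
        exact cfc_congr fun t _ => hkl t
  have hKR : cfc k h * cfc r h = cfc r h := by
    rw [← cfc_mul k r h hk.continuousOn hr.continuousOn]
    exact cfc_congr fun t _ => hkr t
  have hm : IsSelfAdjoint (1 - cfc k h) := (IsSelfAdjoint.one A).sub (cfc_predicate k h)
  have hRm : cfc r h ∈ annihilatorSubalgebra _ hm := by
    refine ⟨by rw [sub_mul, hKR, one_mul, sub_self], ?_⟩
    rw [mul_sub, (cfc_commute_cfc r k h).eq, hKR, mul_one, sub_self]
  -- Otherwise `h` equals its truncation at 3/4, against the norm bound.
  have hR0 : cfc r h ≠ 0 := by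
    intro hzero
    have : h = cfc (fun t : ℝ => min t (3 / 4)) h := by
      have h' : cfc (fun t => t - r t) h = cfc (fun t : ℝ => min t (3 / 4)) h := by
        refine cfc_congr fun t _ => ?_
        rcases le_total t (3 / 4) with ht | ht
        · simp only [r]; rw [max_eq_left (by linarith), min_eq_left ht, sub_zero]
        · simp only [r]; rw [max_eq_right (by linarith), min_eq_right ht]; ring
      rw [← h', cfc_sub (fun t => t) r h continuousOn_id hr.continuousOn, hzero, cfc_id' ℝ h,
        sub_zero]
    have hn : ‖h‖ ≤ 3 / 4 := by
      rw [this]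
      refine norm_cfc_le (by norm_num) fun t ht => ?_
      rw [Real.norm_of_nonneg (le_min (hspec t ht).1 (by norm_num))]
      exact min_le_right _ _
    linarith
  obtain ⟨q, hq, hqp, hq0⟩ := hA _ (isHereditaryCStarSubalgebra_annihilatorSubalgebra hm)
    (fun hbot => hR0 (by rw [hbot] at hRm; exact (NonUnitalStarAlgebra.mem_bot).1 hRm))
  have hkq : cfc k h * q = q := by
    have := hq.1
    rw [sub_mul, one_mul, sub_eq_zero] at this
    exact this.symm
  refine ⟨q, hqp, hq0, ?_, fun f hf => ?_⟩
  · have heq : h * q - q = cfc (fun t => (t - 1) * k t) h * q := by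
      rw [cfc_mul (fun t => t - 1) k h (by fun_prop) hk.continuousOn, mul_assoc, hkq,
        cfc_sub (fun t => t) (fun _ => 1) h continuousOn_id continuousOn_const, cfc_id' ℝ h,
        cfc_const_one ℝ h, sub_mul, one_mul]
    have hle : ‖cfc (fun t => (t - 1) * k t) h‖ ≤ 1 / 2 := by
      refine norm_cfc_le (by norm_num) fun t ht => ?_
      obtain ⟨ht0, ht1⟩ := hspec t ht
      have hk0 : 0 ≤ k t := le_min zero_le_one (le_max_left _ _)
      have hk1 : k t ≤ 1 := min_le_left _ _
      rw [Real.norm_eq_abs, abs_mul, abs_of_nonneg hk0, abs_of_nonpos (by linarith)]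
      rcases le_total t (1 / 2) with ht | ht
      · have : k t = 0 := by
          simp only [k]; rw [max_eq_left (by linarith), min_eq_right zero_le_one]
        rw [this]; norm_num
      · nlinarith
    rw [heq]
    calc _ ≤ ‖cfc (fun t => (t - 1) * k t) h‖ * ‖q‖ := norm_mul_le _ _
      _ ≤ 1 / 2 * 1 := mul_le_mul hle hqp.norm_le (norm_nonneg _) (by norm_num)
      _ = 1 / 2 := mul_one _
  -- Here `q = h * l(h) * q`, so a left unit of `h` fixes `q`.
  · rw [← hkq, ← mul_assoc, ← hfac, ← mul_assoc f, hf]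

/-- A hereditary C*-subalgebra containing `x` contains a projection equivalent to a projection `q`
as soon as `q * (star x * x) * q` is close to `q`. -/
theorem IsHereditaryCStarSubalgebra.exists_projection {D : NonUnitalStarSubalgebra ℂ A}
    (hD : IsHereditaryCStarSubalgebra D) {x q : A} (hx : x ∈ D) (hq : IsStarProjection q)
    (hxq : ‖q - q * (star x * x) * q‖ < 1) :
    ∃ p ∈ D, IsStarProjection p ∧ MurrayVonNeumannEquiv p q := by
  have hqs : star q = q := hq.isSelfAdjoint.star_eq
  have hqq : q * q = q := hq.isIdempotentElem.eq
  -- Adding `1 - q` replaces invertibility in the corner of `q` by invertibility in `A`; `c` and its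
  -- powers commute with `q`.
  obtain ⟨c, hc⟩ : ∃ c, c = q * (star x * x) * q + (1 - q) := ⟨_, rfl⟩
  have hc0 : 0 ≤ c := by
    rw [hc]
    exact add_nonneg (hq.isSelfAdjoint.conjugate_nonneg (star_mul_self_nonneg x))
      hq.one_sub.nonneg
  have hcu : IsUnit c := by
    have := isUnit_one_sub_of_norm_lt_one hxq
    rwa [show 1 - (q - q * (star x * x) * q) = c by rw [hc]; abel] at this
  have hcq : c * q = q * (star x * x) * q := by
    rw [hc, add_mul, hq.one_sub_mul_self, add_zero, mul_assoc _ q q, hqq]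
  have hqc : q * c = q * (star x * x) * q := by
    rw [hc, mul_add, hq.mul_one_sub_self, add_zero, ← mul_assoc, ← mul_assoc, hqq]
  have hsp : IsStrictlyPositive c := hcu.isStrictlyPositive hc0
  obtain ⟨s, hs⟩ : ∃ s, s = c ^ (-(1 / 2) : ℝ) := ⟨_, rfl⟩
  have hss : star s = s := by
    rw [hs]; exact (IsSelfAdjoint.of_nonneg CFC.rpow_nonneg).star_eq
  have hscs : s * c * s = 1 := by rw [hs]; exact CFC.conjugate_rpow_neg_one_half c
  have hsq : s * q = q * s := by
    have hcomm : Commute c q := hcq.trans hqc.symm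
    rw [hs, CFC.rpow_def]
    exact (hcomm.cfc_nnreal _).eq
  -- The partial isometry in the polar decomposition of `x * q`. Its range projection has the form
  -- `x * (positive) * star x`, so it lies in `D` even if `q` does not.
  obtain ⟨w, hw⟩ : ∃ w, w = x * (q * s) := ⟨_, rfl⟩
  have hww : star w * w = q := by
    calc star w * w = s * (q * (star x * x) * q) * s := by
          rw [hw]; simp only [star_mul, hss, hqs, mul_assoc]
      _ = (s * c * s) * q := by rw [← hcq]; simp only [mul_assoc, hsq]
      _ = q := by rw [hscs, one_mul]
  have hwq : w * q = w := by rw [hw, mul_assoc, mul_assoc, hsq, ← mul_assoc q, hqq]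
  refine ⟨w * star w, ?_, ⟨?_, .mul_star_self w⟩, star w, by rw [star_star], by rwa [star_star]⟩
  · have : w * star w = x * (q * s * star (q * s)) * star x := by
      rw [hw, star_mul]; simp only [mul_assoc]
    rw [this]
    exact hD.conjugate_mem hx (mul_star_self_nonneg _)
  · change w * star w * (w * star w) = w * star w
    rw [mul_assoc, ← mul_assoc (star w), hww, ← mul_assoc, hwq]

end Hereditary

/-! ### Corners by orthogonal projections -/

section Orthogonal

variable {G A : Type*} [Fintype G] [CStarAlgebra A] {e : G → A}

theorem isStarProjection_sum (hp : ∀ g, IsStarProjection (e g))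
    (ho : ∀ g h, g ≠ h → e g * e h = 0) : IsStarProjection (∑ g, e g) := by
  refine ⟨?_, isSelfAdjoint_sum _ fun g _ => (hp g).isSelfAdjoint⟩
  change (∑ g, e g) * ∑ g, e g = _
  rw [Finset.sum_mul_sum]
  refine Finset.sum_congr rfl fun g _ => ?_
  rw [Finset.sum_eq_single g (fun h _ hh => ho g h hh.symm) (by simp)]
  exact (hp g).isIdempotentElem

variable [PartialOrder A] [StarOrderedRing A]

/-- Each corner is at most `M • e g`, and the `e g` sum to a projection, so no factor `card G` is
lost. -/
theorem norm_sum_conjugate_le (hp : ∀ g, IsStarProjection (e g))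
    (ho : ∀ g h, g ≠ h → e g * e h = 0) {b : A} (hb : 0 ≤ b) {M : ℝ} (hM : 0 ≤ M)
    (h : ∀ g, ‖e g * b * e g‖ ≤ M) : ‖∑ g, e g * b * e g‖ ≤ M := by
  have hpos : ∀ g, 0 ≤ e g * b * e g := fun g => (hp g).isSelfAdjoint.conjugate_nonneg hb
  have hle : ∀ g, e g * b * e g ≤ M • e g := by
    intro g
    have hi := (hp g).isIdempotentElem.eq
    have := (hp g).isSelfAdjoint.conjugate_le_conjugate
      ((CStarAlgebra.norm_le_iff_le_algebraMap _ hM (hpos g)).1 (h g))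
    rwa [Algebra.algebraMap_eq_smul_one, mul_smul_comm, mul_one, smul_mul_assoc, hi,
      mul_assoc _ _ (e g), mul_assoc _ (e g), hi, ← mul_assoc, ← mul_assoc, hi] at this
  rw [CStarAlgebra.norm_le_iff_le_algebraMap _ hM (Finset.sum_nonneg fun g _ => hpos g),
    Algebra.algebraMap_eq_smul_one]
  refine (Finset.sum_le_sum fun g _ => hle g).trans ?_
  rw [← Finset.smul_sum]
  exact smul_le_smul_of_nonneg_left
    (sub_nonneg.1 (isStarProjection_sum hp ho).one_sub.nonneg) hM

/-- If orthogonal projections almost commute with a positive element `b`, then one of the corners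
of `b` has almost the norm of the corner by their sum. -/
theorem exists_lt_norm_conjugate (hp : ∀ g, IsStarProjection (e g))
    (ho : ∀ g h, g ≠ h → e g * e h = 0) {b : A} (hb : 0 ≤ b) {ε M : ℝ} (hM : 0 ≤ M)
    (hε : ∀ g, ‖e g * b - b * e g‖ ≤ ε)
    (h : M + Fintype.card G ^ 2 * ε < ‖(∑ g, e g) * b * ∑ g, e g‖) :
    ∃ g, M < ‖e g * b * e g‖ := by
  classical
  by_contra! hcon
  refine absurd h (not_lt.2 ?_)
  -- Off the diagonal, `e g * b * e k` is a commutator times `e k`, because `e g * e k = 0`.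
  have hterm : ∀ g k, ‖e g * b * e k - if g = k then e g * b * e g else 0‖ ≤ ε := by
    intro g k
    by_cases hgk : g = k
    · subst hgk; simpa using (norm_nonneg _).trans (hε g)
    · have : e g * b * e k = (e g * b - b * e g) * e k := by
        rw [sub_mul, mul_assoc b, ho g k hgk, mul_zero, sub_zero]
      rw [if_neg hgk, sub_zero, this]
      exact (norm_mul_le _ _).trans
        ((mul_le_of_le_one_right (norm_nonneg _) (hp k).norm_le).trans (hε g))
  have hsum : (∑ g, e g) * b * (∑ g, e g) = (∑ g, e g * b * e g) +
      ∑ g, ∑ k, (e g * b * e k - if g = k then e g * b * e g else 0) := by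
    simp only [Finset.sum_sub_distrib, Finset.sum_ite_eq, Finset.mem_univ, if_true,
      Finset.sum_mul, Finset.mul_sum]
    rw [Finset.sum_comm]; abel
  rw [hsum]
  refine (norm_add_le _ _).trans (add_le_add (norm_sum_conjugate_le hp ho hb hM hcon) ?_)
  calc _ ≤ ∑ g : G, ∑ k : G, ε := (norm_sum_le _ _).trans
        (Finset.sum_le_sum fun g _ => (norm_sum_le _ _).trans
          (Finset.sum_le_sum fun k _ => hterm g k))
    _ = Fintype.card G ^ 2 * ε := by simp [sq, mul_assoc]

end Orthogonal

/-! ### Compressing elements of the crossed product -/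

namespace CrossedProduct

variable {G A : Type*} [Group G] [Fintype G] [CStarAlgebra A] {α : G →* (A ≃⋆ₐ[ℂ] A)}

theorem star_mul_self_coeff_one (x : CrossedProduct α) :
    (star x * x).coeff 1 = ∑ s, α s (star (x.coeff s⁻¹) * x.coeff s⁻¹) := by
  simp only [mul_apply, star_apply, mul_one, map_mul]

variable [PartialOrder A] [StarOrderedRing A]

theorem star_mul_self_coeff_one_nonneg (x : CrossedProduct α) : 0 ≤ (star x * x).coeff 1 := by
  rw [star_mul_self_coeff_one]
  exact Finset.sum_nonneg fun s _ => map_nonneg (α s) (star_mul_self_nonneg _)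

/-- Faithfulness of the expectation: a sum of positive terms, one per coefficient of `x`, vanishes
only if each term does. -/
theorem star_mul_self_coeff_one_ne_zero {x : CrossedProduct α} (hx : x ≠ 0) :
    (star x * x).coeff 1 ≠ 0 := by
  intro h
  rw [star_mul_self_coeff_one, Finset.sum_eq_zero_iff_of_nonneg
    fun s _ => map_nonneg (α s) (star_mul_self_nonneg _)] at h
  refine hx (CrossedProduct.ext (funext fun t => ?_))
  have := h t⁻¹ (Finset.mem_univ _)
  rw [inv_inv] at this
  exact (CStarRing.star_mul_self_eq_zero_iff _).1 ((map_eq_zero_iff (α t⁻¹)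
    (EquivLike.injective _)).1 this)

variable [DecidableEq G]

theorem norm_of_le (a : A) : ‖of α a‖ ≤ ‖a‖ := NonUnitalStarAlgHom.norm_apply_le _ a

theorem u_mem_unitary (g : G) : u α g ∈ unitary (CrossedProduct α) := by
  have h1 : u α 1 = 1 := rfl
  rw [Unitary.mem_iff, star_u, u_mul_u, u_mul_u, inv_mul_cancel, mul_inv_cancel, h1]
  exact ⟨rfl, rfl⟩

theorem norm_mul_u (x : CrossedProduct α) (g : G) : ‖x * u α g‖ = ‖x‖ :=
  CStarRing.norm_mul_coe_unitary x ⟨u α g, u_mem_unitary g⟩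

/-- Compressing to a projection `f` that almost commutes with the coefficients of `a` and is almost
orthogonal to its translates almost yields the compression of the expectation of `a`. -/
theorem norm_conjugate_sub_le {a : CrossedProduct α} {f : A} {ε : ℝ} (hf : ‖f‖ ≤ 1)
    (h1 : ∀ g, ‖f * a.coeff g - a.coeff g * f‖ ≤ ε) (h2 : ∀ g, g ≠ 1 → ‖f * α g f‖ ≤ ε) :
    ‖of α f * a * of α f - of α (f * a.coeff 1 * f)‖ ≤
      ∑ g, (1 + ‖a.coeff g‖) * ε := by
  have hε : 0 ≤ ε := (norm_nonneg _).trans (h1 1)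
  -- Moving the right-hand `f` past `u α g` turns it into `α g f`; the subtracted term is the one at
  -- `g = 1`.
  have heq : of α f * a * of α f - of α (f * a.coeff 1 * f) =
      ∑ g, if g = 1 then 0 else of α (f * a.coeff g * α g f) * u α g := by
    have ha : of α f * a * of α f = ∑ g, of α (f * a.coeff g * α g f) * u α g := by
      conv_lhs => rw [eq_sum a]
      rw [Finset.mul_sum, Finset.sum_mul]
      refine Finset.sum_congr rfl fun g _ => ?_
      rw [mul_assoc, mul_assoc, u_mul_of, map_mul, map_mul]
      simp only [mul_assoc]
    have hu : u α 1 = 1 := rfl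
    rw [ha, Finset.sum_ite, Finset.sum_const_zero, zero_add, sub_eq_iff_eq_add,
      ← Finset.sum_filter_not_add_sum_filter _ (fun g => g = 1)]
    congr 1
    rw [Finset.filter_eq' Finset.univ (1 : G), if_pos (Finset.mem_univ _), Finset.sum_singleton,
      hu, mul_one, map_one]
    rfl
  rw [heq]
  refine (norm_sum_le _ _).trans (Finset.sum_le_sum fun g _ => ?_)
  split_ifs with hg
  · rw [norm_zero]; positivity
  · rw [norm_mul_u]
    refine (norm_of_le _).trans ?_
    have hsplit : f * a.coeff g * α g f =
        (f * a.coeff g - a.coeff g * f) * α g f + a.coeff g * (f * α g f) := by noncomm_ring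
    have hαf : ‖α g f‖ ≤ 1 :=
      (NonUnitalStarAlgHom.norm_map (α g) (EquivLike.injective _) f).trans_le hf
    rw [hsplit, add_mul, one_mul]
    refine (norm_add_le _ _).trans (add_le_add ?_ ?_)
    · exact (norm_mul_le _ _).trans
        ((mul_le_of_le_one_right (norm_nonneg _) hαf).trans (h1 g))
    · exact (norm_mul_le _ _).trans (mul_le_mul_of_nonneg_left (h2 g hg) (norm_nonneg _))

/-- If the expectation of `a` is positive of norm one, then there is a nonzero projection `q` of the
coefficient algebra at distance less than one from the compression of `a` to `q`. -/
theorem exists_projection_of_weakTracialRokhlin (hA : PropertySP A) (hα : WeakTracialRokhlin α)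
    {a : CrossedProduct α} (ha : 0 ≤ a.coeff 1) (ha1 : ‖a.coeff 1‖ = 1) :
    ∃ q : A, IsStarProjection q ∧ q ≠ 0 ∧ ‖of α q - of α q * a * of α q‖ < 1 := by
  obtain ⟨S, hS⟩ : ∃ S : ℝ, S = ∑ g, (1 + ‖a.coeff g‖) := ⟨_, rfl⟩
  have hS0 : 0 ≤ S := by rw [hS]; positivity
  -- The terms `1` and `card G ^ 2` give `3 / 4 + card G ^ 2 * ε ≤ 1 - ε`; the term `S` keeps the
  -- compression error `S * ε` at most 1/4.
  obtain ⟨ε, hε⟩ : ∃ ε : ℝ, ε = 1 / (4 * (1 + (Fintype.card G : ℝ) ^ 2 + S)) := ⟨_, rfl⟩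
  have hε0 : 0 < ε := by rw [hε]; positivity
  have hεe : (1 + (Fintype.card G : ℝ) ^ 2 + S) * ε = 1 / 4 := by rw [hε]; field_simp
  have hfull : IsFullElement (1 : A) := by
    have htop : (TwoSidedIdeal.span {(1 : A)}) = ⊤ := by
      rw [← TwoSidedIdeal.one_mem_iff]
      exact TwoSidedIdeal.subset_span rfl
    rw [IsFullElement, htop]
    simp
  classical
  obtain ⟨e, hp, ho, hαe, hcom, -, hbig⟩ := hα (Finset.univ.image a.coeff) ε hε0 (a.coeff 1) ha ha1
    1 zero_le_one hfull
  have hcom' : ∀ g t, ‖e g * a.coeff t - a.coeff t * e g‖ ≤ ε := fun g t =>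
    (hcom g _ (Finset.mem_image_of_mem _ (Finset.mem_univ t))).le
  obtain ⟨g, hg⟩ := exists_lt_norm_conjugate hp ho ha (M := 3 / 4) (by norm_num)
    (fun g => hcom' g 1) (by nlinarith [mul_nonneg hS0 hε0.le])
  -- `α t (e g)` is within `ε` of `e (t * g)`, which is orthogonal to `e g`.
  have horth : ∀ t, t ≠ 1 → ‖e g * α t (e g)‖ ≤ ε := by
    intro t ht
    have : e g * α t (e g) = e g * (α t (e g) - e (t * g)) := by
      rw [mul_sub, ho g (t * g) (by simpa using ht), sub_zero]
    rw [this]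
    exact (norm_mul_le _ _).trans
      ((mul_le_of_le_one_left (norm_nonneg _) (hp g).norm_le).trans (hαe t g).le)
  have hcomp := norm_conjugate_sub_le (hp g).norm_le (hcom' g) horth
  rw [← Finset.sum_mul, ← hS] at hcomp
  have hle : ‖e g * a.coeff 1 * e g‖ ≤ 1 := by
    have := (hp g).norm_le
    calc _ ≤ ‖e g‖ * ‖a.coeff 1‖ * ‖e g‖ := norm_mul₃_le
      _ ≤ 1 * 1 * 1 := by gcongr; exact ha1.le
      _ = 1 := by norm_num
  obtain ⟨q, hq, hq0, hhq, hfix⟩ := hA.exists_projection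
    ((hp g).isSelfAdjoint.conjugate_nonneg ha) hle hg
  have hfq : e g * q = q :=
    hfix _ (by rw [← mul_assoc, ← mul_assoc, (hp g).isIdempotentElem.eq])
  have hqf : q * e g = q := by
    simpa [(hp g).isSelfAdjoint.star_eq, hq.isSelfAdjoint.star_eq] using congr(star $hfq)
  have hqq : q * q = q := hq.isIdempotentElem.eq
  refine ⟨q, hq, hq0, ?_⟩
  -- As `q` lies under `e g`, the error splits into that of Property (SP), at most 1/2, and that of
  -- the compression, at most `S * ε`.
  have hsplit : of α q - of α q * a * of α q =
      -(of α (q * (e g * a.coeff 1 * e g * q - q)) + of α q *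
        (of α (e g) * a * of α (e g) - of α (e g * a.coeff 1 * e g)) * of α q) := by
    have e1 : of α q * (of α (e g) * a * of α (e g)) * of α q = of α q * a * of α q := by
      calc _ = of α (q * e g) * a * of α (e g * q) := by simp only [map_mul, mul_assoc]
        _ = _ := by rw [hfq, hqf]
    rw [mul_sub (of α q), sub_mul, e1, mul_sub q, hqq]
    simp only [map_sub, map_mul, mul_assoc]
    abel
  have hqn : ‖of α q‖ ≤ 1 := (norm_of_le q).trans hq.norm_le
  rw [hsplit, norm_neg]
  calc _ ≤ 1 / 2 + S * ε := by
        refine (norm_add_le _ _).trans (add_le_add ?_ ?_)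
        · exact (norm_of_le _).trans ((norm_mul_le _ _).trans
            ((mul_le_of_le_one_left (norm_nonneg _) hq.norm_le).trans hhq))
        · exact norm_mul₃_le.trans ((mul_le_of_le_one_right (by positivity) hqn).trans
            ((mul_le_of_le_one_left (norm_nonneg _) hqn).trans hcomp))
    _ < 1 := by nlinarith [mul_nonneg (sq_nonneg (Fintype.card G : ℝ)) hε0.le]

end CrossedProduct

/-! ### Property (SP) for the crossed product -/

theorem mainTheorem8 {G A : Type*} [Group G] [Fintype G] [DecidableEq G]
    [CStarAlgebra A] [PartialOrder A] [StarOrderedRing A]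
    (α : G →* (A ≃⋆ₐ[ℂ] A)) (hA : PropertySP A) (hα : WeakTracialRokhlin α) :
    PropertySP (CrossedProduct α) ∧
      ∀ D : NonUnitalStarSubalgebra ℂ (CrossedProduct α),
        IsHereditaryCStarSubalgebra D → D ≠ ⊥ →
          ∃ p ∈ D, IsStarProjection p ∧ p ≠ 0 ∧
            ∃ q : A, IsStarProjection q ∧
              MurrayVonNeumannEquiv p (CrossedProduct.of α q) := by
  have main : ∀ D : NonUnitalStarSubalgebra ℂ (CrossedProduct α),
        IsHereditaryCStarSubalgebra D → D ≠ ⊥ →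
          ∃ p ∈ D, IsStarProjection p ∧ p ≠ 0 ∧
            ∃ q : A, IsStarProjection q ∧
              MurrayVonNeumannEquiv p (CrossedProduct.of α q) := by
    intro D hD hD0
    obtain ⟨y, hyD, hy0⟩ : ∃ y ∈ D, y ≠ 0 := by
      by_contra! hcon
      exact hD0 (eq_bot_iff.2 fun y hy => NonUnitalStarAlgebra.mem_bot.2 (hcon y hy))
    have hn := norm_pos_iff.2 (CrossedProduct.star_mul_self_coeff_one_ne_zero hy0)
    obtain ⟨n, hnn⟩ : ∃ n : ℝ, n = ‖(star y * y).coeff 1‖ := ⟨_, rfl⟩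
    rw [← hnn] at hn
    -- Scaling `y` by `c` multiplies the identity coefficient of `star y * y` by `c * c = n⁻¹`.
    obtain ⟨c, hc⟩ : ∃ c : ℝ, c = (√n)⁻¹ := ⟨_, rfl⟩
    have hx : (star ((c : ℂ) • y) * ((c : ℂ) • y)).coeff 1 =
        ((c * c : ℝ) : ℂ) • (star y * y).coeff 1 := by
      rw [star_smul, smul_mul_smul_comm, CrossedProduct.smul_apply]
      simp
    obtain ⟨q, hq, hq0, hqx⟩ := CrossedProduct.exists_projection_of_weakTracialRokhlin hA hα
      (a := star ((c : ℂ) • y) * ((c : ℂ) • y))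
      (CrossedProduct.star_mul_self_coeff_one_nonneg _) (by
        rw [hx, norm_smul, ← hnn, Complex.norm_real, Real.norm_of_nonneg (mul_self_nonneg c), hc,
          ← mul_inv, Real.mul_self_sqrt hn.le, inv_mul_cancel₀ hn.ne'])
    obtain ⟨p, hpD, hp, v, hv, hv'⟩ := hD.exists_projection (SMulMemClass.smul_mem (c : ℂ) hyD)
      (hq.map (CrossedProduct.of α)) hqx
    refine ⟨p, hpD, hp, ?_, q, hq, v, hv, hv'⟩
    -- If `p = 0` then `v = 0`, so `of α q = 0`, and its identity coefficient `q` vanishes.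
    rintro rfl
    rw [CStarRing.star_mul_self_eq_zero_iff] at hv
    rw [hv, zero_mul] at hv'
    refine hq0 ?_
    have := congrArg (fun z : CrossedProduct α => z.coeff 1) hv'
    simpa [CrossedProduct.of_apply, CrossedProduct.zero_apply] using this.symm
  refine ⟨fun D hD hD0 => ?_, main⟩
  obtain ⟨p, hpD, hp, hp0, -⟩ := main D hD hD0
  exact ⟨p, hpD, hp, hp0⟩
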